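/- Let $k$ be an algebraically closed field of characteristic zero, let $A$ be a finitely generated commutative associative unital $k$-algebra, and let $\mathfrak g$ be a finite-dimensional semisimple Lie algebra over $k$. Let $\Gamma$ be a finite abelian group acting on $A$ by $k$-algebra automorphisms and on $\mathfrak g$ by $k$-Lie algebra automorphisms. Let $X=\operatorname{Spec}A$ and let $X_{\mathrm{rat}}$ be its set of rational points, i.e. of those points $x$, with corresponding ideal $\mathfrak m_x$, such that $A/\mathfrak m_x\cong k$ as $k$-algebras. The group $\Gamma$ acts on $X_{\mathrm{rat}}$ by $\mathfrak m_{\gamma\cdot x}=\gamma\cdot\mathfrak m_x$, and this action is assumed to be free. Let $(\mathfrak g\otimes_k A)^\Gamma$ be the Lie algebra of fixed points of the diagonal action of $\Gamma$ on $\mathfrak g\otimes_k A$, where $[a\otimes f,b\otimes h]=[a,b]\otimes fh$. For an ideal $I$ of $A$ put $(\mathfrak g\otimes I)^\Gamma=(\mathfrak g\otimes I)\cap(\mathfrak g\otimes A)^\Gamma$. For a function $\eta:X_{\mathrm{rat}}\to\mathbb N=\mathbb Z_{\ge 0}$ with finite support $\operatorname{Supp}\eta=\{x:\eta(x)\neq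 0\}$ put $I_\eta=\prod_{x\in\operatorname{Supp}\eta}\mathfrak m_x^{\eta(x)}$. Let $X_*$ be the set of finite subsets of $X_{\mathrm{rat}}$ whose distinct elements have disjoint $\Gamma$-orbits. Then for every finite-dimensional $(\mathfrak g\otimes A)^\Gamma$-module $V$ there is a finitely supported $\eta:X_{\mathrm{rat}}\to\mathbb N$ with $\operatorname{Supp}\eta\in X_*$ such that $(\mathfrak g\otimes I_\eta)^\Gamma$ annihilates $V$, i.e. $\alpha\cdot v=0$ for all $\alpha\in(\mathfrak g\otimes I_\eta)^\Gamma$ and $v\in V$. -/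

import Mathlib

open scoped TensorProduct Pointwise

/-- A monoid acting on a Lie ring by additive maps preserving the bracket. For a group `Γ`, together
with `SMulCommClass Γ k g`, this is an action on the `k`-Lie algebra `g` by automorphisms. -/
class MulLieAction (Γ g : Type*) [Monoid Γ] [LieRing g] extends DistribMulAction Γ g where
  smul_lie : ∀ (γ : Γ) (x y : g), γ • ⁅x, y⁆ = ⁅γ • x, γ • y⁆

/-- The rational points of `Spec A`: the points `x` with `A / 𝔪_x ≅ k` as `k`-algebras. -/
def RationalPoint (k A : Type*) [Field k] [CommRing A] [Algebra k A] : Type _ :=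
  {x : PrimeSpectrum A // Nonempty ((A ⧸ x.asIdeal) ≃ₐ[k] k)}

namespace RationalPoint

variable {k A : Type*} [Field k] [CommRing A] [Algebra k A]

/-- The ideal `𝔪_x` of the rational point `x`. -/
def ideal (x : RationalPoint k A) : Ideal A := x.1.asIdeal

theorem ext_ideal {x y : RationalPoint k A} (h : x.ideal = y.ideal) : x = y :=
  Subtype.ext (PrimeSpectrum.ext h)

variable {Γ : Type*} [Group Γ] [MulSemiringAction Γ A] [SMulCommClass Γ k A]

/-- The action of `Γ` on rational points, `𝔪_{γ • x} = γ • 𝔪_x`. -/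
instance : MulAction Γ (RationalPoint k A) where
  smul γ x :=
    ⟨⟨γ • x.ideal, by
        have : x.ideal.IsPrime := x.1.isPrime
        infer_instance⟩,
      x.2.map fun e =>
        (Ideal.quotientEquivAlg x.ideal (γ • x.ideal) (MulSemiringAction.toAlgEquiv k A γ)
          rfl).symm.trans e⟩
  one_smul x := ext_ideal (one_smul Γ x.ideal)
  mul_smul γ δ x := ext_ideal (mul_smul γ δ x.ideal)

theorem ideal_smul (γ : Γ) (x : RationalPoint k A) : (γ • x).ideal = γ • x.ideal := rfl

end RationalPoint

/-- `X_*`: the finite sets of rational points whose distinct elements have disjoint `Γ`-orbits. -/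
def XStar (Γ k A : Type*) [Group Γ] [Field k] [CommRing A] [Algebra k A]
    [MulSemiringAction Γ A] [SMulCommClass Γ k A] : Set (Finset (RationalPoint k A)) :=
  {s | ∀ x ∈ s, ∀ y ∈ s, x ≠ y → Disjoint (MulAction.orbit Γ x) (MulAction.orbit Γ y)}

/-- `I_η = ∏_{x ∈ Supp η} 𝔪_x ^ η(x)`, for `η : X_rat → ℕ` of finite support. -/
noncomputable def idealOfFun {k A : Type*} [Field k] [CommRing A] [Algebra k A]
    (η : RationalPoint k A →₀ ℕ) : Ideal A :=
  ∏ x ∈ η.support, x.ideal ^ η x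

section EquivariantMapAlgebra

variable (Γ k A g : Type*) [Group Γ] [Field k] [CommRing A] [Algebra k A]
  [MulSemiringAction Γ A] [SMulCommClass Γ k A]
  [LieRing g] [LieAlgebra k g] [MulLieAction Γ g] [SMulCommClass Γ k g]

variable {Γ} in
/-- The action of `γ` on `g` as a homomorphism of Lie algebras. -/
def MulLieAction.toLieHom (γ : Γ) : g →ₗ⁅k⁆ g where
  toLinearMap := DistribSMul.toLinearMap k g γ
  map_lie' {x y} := MulLieAction.smul_lie γ x y

variable {Γ} in
/-- The diagonal action of `γ` on the map algebra: `γ • (f ⊗ a) = (γ • f) ⊗ (γ • a)`. The map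
algebra `g ⊗ A` is written with the factors in the order `A ⊗[k] g`, which carries the bracket
`⁅f ⊗ a, f' ⊗ b⁆ = f f' ⊗ ⁅a, b⁆`. -/
noncomputable def diagonalAction (γ : Γ) : A ⊗[k] g →ₗ⁅k⁆ A ⊗[k] g :=
  LieAlgebra.ExtendScalars.map (MulSemiringAction.toAlgHom k A γ) (MulLieAction.toLieHom k g γ)

/-- The equivariant map algebra `(g ⊗ A)^Γ`. -/
noncomputable def equivariantMapAlgebra : LieSubalgebra k (A ⊗[k] g) where
  carrier := {z | ∀ γ : Γ, diagonalAction k A g γ z = z}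
  add_mem' {x y} hx hy γ := by rw [map_add, hx γ, hy γ]
  zero_mem' γ := map_zero _
  smul_mem' c x hx γ := by rw [map_smul, hx γ]
  lie_mem' {x y} hx hy γ := by
    rw [LieHom.map_lie]
    exact congrArg₂ _ (hx γ) (hy γ)

/-- `g ⊗ I`, for an ideal `I` of `A`, as a subspace of the map algebra. -/
noncomputable def tensorIdeal {A : Type*} [CommRing A] [Algebra k A] (I : Ideal A) :
    Submodule k (A ⊗[k] g) :=
  LinearMap.range (LinearMap.rTensor g (I.restrictScalars k).subtype)

/-- `(g ⊗ I)^Γ = (g ⊗ I) ∩ (g ⊗ A)^Γ`, as a subspace of `(g ⊗ A)^Γ`. -/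
noncomputable def equivariantTensorIdeal {A : Type*} [CommRing A] [Algebra k A]
    [MulSemiringAction Γ A] [SMulCommClass Γ k A] (I : Ideal A) :
    Submodule k (equivariantMapAlgebra Γ k A g) :=
  (tensorIdeal k g I).comap (equivariantMapAlgebra Γ k A g).toSubmodule.subtype

end EquivariantMapAlgebra

/-! Let `J` be the largest ideal of `A` such that all traces `∑ γ • z`, for `z` in `g ⊗ J`, kill
`V`. The crux is that `J` has finite codimension. Freeness yields a Galois tensor `∑ p₁ ⊗ p₂` with
`∑ p₁ * γ • p₂ = δ_{γ,1}`, so the trace of `ab ⊗ ⁅u, w⁆` is a finite sum of brackets of traces of `a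
p₁ ⊗ u` and `b p₂ ⊗ w` (`equivariantTrace_mul_tmul_lie`). As `g` is perfect, `a ∈ J` once the traces
of all `a p₁ ⊗ u` kill `V`: finitely many linear conditions.

By the Nullstellensatz `J` then contains a product of ideals `𝔪_x`. Moving each `x` to an orbit
representative loses nothing, because an invariant element of `g ⊗ I` lies in `g ⊗ γI` for every
`γ`. Finally an invariant `α` is its trace divided by `|Γ|`, so `α` in `g ⊗ J` kills `V`. -/

/-! ### Perfectness of semisimple Lie algebras -/

namespace LieAlgebra.IsSemisimple

variable (k g : Type*) [Field k] [LieRing g] [LieAlgebra k g] [LieAlgebra.IsSemisimple k g]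

/-- A semisimple Lie algebra is perfect. -/
theorem lie_top_top : ⁅(⊤ : LieIdeal k g), (⊤ : LieIdeal k g)⁆ = ⊤ := by
  refine top_le_iff.mp ?_
  rw [← LieAlgebra.IsSemisimple.sSup_atoms_eq_top (R := k) (L := g)]
  refine sSup_le fun I hI => ?_
  have hle : ⁅I, I⁆ ≤ I := LieSubmodule.lie_le_right I I
  rcases hI.le_iff.mp hle with h | h
  · exact absurd ((LieSubmodule.lie_abelian_iff_lie_self_eq_bot I).mpr h)
      (LieAlgebra.IsSemisimple.non_abelian_of_isAtom I hI)
  · calc I = ⁅I, I⁆ := h.symm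
      _ ≤ _ := LieSubmodule.mono_lie (by simp) (by simp)

theorem span_lie_eq_top : Submodule.span k {x : g | ∃ u w : g, ⁅u, w⁆ = x} = ⊤ := by
  have h := congrArg LieSubmodule.toSubmodule (lie_top_top k g)
  rw [LieSubmodule.lieIdeal_oper_eq_linear_span'] at h
  simpa using h

end LieAlgebra.IsSemisimple

/-! ### Rational points and ideals of finite codimension -/

namespace RationalPoint

variable (k : Type*) {A : Type*} [Field k] [CommRing A] [Algebra k A]

theorem isMaximal_ideal (x : RationalPoint k A) : x.ideal.IsMaximal := by
  obtain ⟨e⟩ := x.2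
  exact Ideal.Quotient.maximal_of_isField _ (e.toMulEquiv.isField (Field.toIsField k))

/-- The weak Nullstellensatz: every maximal ideal of an algebra of finite type over an
algebraically closed field is the ideal of a rational point. -/
theorem exists_ideal_eq [IsAlgClosed k] [Algebra.FiniteType k A] (m : Ideal A) [hm : m.IsMaximal] :
    ∃ x : RationalPoint k A, x.ideal = m := by
  let _ : Field (A ⧸ m) := Ideal.Quotient.field m
  have : Module.Finite k (A ⧸ m) := finite_of_finite_type_of_isJacobsonRing k (A ⧸ m)
  have hb : Function.Bijective (algebraMap k (A ⧸ m)) :=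
    IsAlgClosed.algebraMap_bijective_of_isIntegral
  exact ⟨⟨⟨m, hm.isPrime⟩, ⟨(AlgEquiv.ofBijective (Algebra.ofId k (A ⧸ m)) hb).symm⟩⟩, rfl⟩

/-- An ideal of finite codimension contains a product of ideals of rational points. -/
theorem exists_multiset_prod_le [IsAlgClosed k] [Algebra.FiniteType k A] (J : Ideal A)
    [Module.Finite k (A ⧸ J)] :
    ∃ Z : Multiset (RationalPoint k A), (Z.map ideal).prod ≤ J := by
  have : IsArtinianRing (A ⧸ J) := IsArtinianRing.of_finite k (A ⧸ J)
  obtain ⟨Z, hZ⟩ := PrimeSpectrum.exists_primeSpectrum_prod_le (A ⧸ J) ⊥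
  -- Primes of an Artinian ring are maximal, so their preimages in `A` come from rational points.
  have hmax (p : PrimeSpectrum (A ⧸ J)) :
      ∃ x : RationalPoint k A, x.ideal = p.asIdeal.comap (Ideal.Quotient.mk J) := by
    have : p.asIdeal.IsMaximal := inferInstance
    have := Ideal.comap_isMaximal_of_surjective (Ideal.Quotient.mk J)
      Ideal.Quotient.mk_surjective (K := p.asIdeal)
    exact exists_ideal_eq k _
  choose f hf using hmax
  refine ⟨Z.map f, ?_⟩
  have hmap : ((Z.map f).map ideal).prod.map (Ideal.Quotient.mk J) =
      (Z.map PrimeSpectrum.asIdeal).prod := by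
    rw [← Ideal.mapHom_apply, map_multiset_prod, Multiset.map_map, Multiset.map_map]
    refine congrArg _ (Multiset.map_congr rfl fun p _ => ?_)
    simp only [Function.comp_apply, Ideal.mapHom_apply, hf]
    exact Ideal.map_comap_of_surjective _ Ideal.Quotient.mk_surjective _
  have h := Ideal.le_comap_of_map_le (hmap.trans_le hZ)
  rwa [← RingHom.ker_eq_comap_bot, Ideal.mk_ker] at h

end RationalPoint

/-! ### The Galois tensor of a free action -/

section Galois

variable {k A Γ : Type*} [Field k] [CommRing A] [Algebra k A]
  [Group Γ] [MulSemiringAction Γ A] [SMulCommClass Γ k A]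

variable (k A) in
/-- The algebra homomorphism `a ⊗ b ↦ a * γ • b`. -/
noncomputable def twistedMul (γ : Γ) : A ⊗[k] A →ₐ[k] A :=
  Algebra.TensorProduct.lift (AlgHom.id k A) (MulSemiringAction.toAlgHom k A γ)
    fun _ _ => Commute.all _ _

theorem twistedMul_tmul (γ : Γ) (a b : A) : twistedMul k A γ (a ⊗ₜ b) = a * γ • b := by
  simp [twistedMul]

/-- Otherwise the image under multiplication of the kernel of the twisted map lies in some `𝔪_x`. It
contains every `f - γ • f`, which forces `γ • 𝔪_x = 𝔪_x`. -/
theorem exists_twistedMul_eq_one_and_eq_zero [IsAlgClosed k] [Algebra.FiniteType k A] {γ : Γ}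
    (hγ : ∀ x : RationalPoint k A, γ • x ≠ x) :
    ∃ t : A ⊗[k] A, twistedMul k A (1 : Γ) t = 1 ∧ twistedMul k A γ t = 0 := by
  have hsurj : Function.Surjective (twistedMul k A (1 : Γ)) := fun a =>
    ⟨a ⊗ₜ 1, by simp [twistedMul_tmul]⟩
  let I : Ideal A := (RingHom.ker (twistedMul k A γ)).map (twistedMul k A (1 : Γ))
  suffices hI : I = ⊤ by
    have h1 : (1 : A) ∈ I := hI ▸ Submodule.mem_top
    obtain ⟨t, ht, h⟩ := (Ideal.mem_map_iff_of_surjective _ hsurj).mp h1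
    exact ⟨t, h, ht⟩
  by_contra hI
  obtain ⟨m, hm, hle⟩ := Ideal.exists_le_maximal I hI
  obtain ⟨x, rfl⟩ := RationalPoint.exists_ideal_eq k m
  have hsub (f : A) : f - γ • f ∈ x.ideal := by
    refine hle ?_
    have : (1 ⊗ₜ f - (γ • f) ⊗ₜ 1 : A ⊗[k] A) ∈ RingHom.ker (twistedMul k A γ) := by
      simp [RingHom.mem_ker, twistedMul_tmul]
    simpa [twistedMul_tmul] using Ideal.mem_map_of_mem (twistedMul k A (1 : Γ)) this
  refine hγ x (RationalPoint.ext_ideal ?_)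
  have hmax := RationalPoint.isMaximal_ideal k (γ • x)
  refine hmax.eq_of_le hm.ne_top fun f hf => ?_
  rw [RationalPoint.ideal_smul] at hf
  have h := add_mem (Ideal.mem_pointwise_smul_iff_inv_smul_mem.mp hf) (neg_mem (hsub (γ⁻¹ • f)))
  simpa using h

/-- A free action of a finite group is Galois: some tensor is sent to `1` by multiplication and to
`0` by all nontrivially twisted multiplications. -/
theorem exists_twistedMul_eq_ite [IsAlgClosed k] [Algebra.FiniteType k A] [Finite Γ]
    [DecidableEq Γ] (hfree : ∀ (γ : Γ) (x : RationalPoint k A), γ • x = x → γ = 1) :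
    ∃ t : A ⊗[k] A, ∀ γ : Γ, twistedMul k A γ t = if γ = 1 then 1 else 0 := by
  have := Fintype.ofFinite Γ
  have h (γ : Γ) : ∃ t : A ⊗[k] A, twistedMul k A (1 : Γ) t = 1 ∧
      (γ ≠ 1 → twistedMul k A γ t = 0) := by
    by_cases hγ : γ = 1
    · exact ⟨1, map_one _, fun h => absurd hγ h⟩
    · obtain ⟨t, h1, h0⟩ := exists_twistedMul_eq_one_and_eq_zero (k := k) (A := A) (γ := γ)
        fun x hx => hγ (hfree γ x hx)
      exact ⟨t, h1, fun _ => h0⟩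
  choose t h1 h0 using h
  -- Twisted multiplications are ring homomorphisms, so one vanishing factor suffices.
  refine ⟨∏ γ, t γ, fun γ => ?_⟩
  rw [map_prod]
  split_ifs with hγ
  · subst hγ
    exact Finset.prod_eq_one fun γ _ => h1 γ
  · exact Finset.prod_eq_zero (Finset.mem_univ γ) (h0 γ hγ)

end Galois

/-! ### Traces and their brackets -/

section Trace

variable {k A g Γ : Type*} [Field k] [CommRing A] [Algebra k A]
  [LieRing g] [LieAlgebra k g] [Group Γ]
  [MulSemiringAction Γ A] [SMulCommClass Γ k A] [MulLieAction Γ g] [SMulCommClass Γ k g]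

theorem diagonalAction_tmul (γ : Γ) (a : A) (u : g) :
    diagonalAction k A g γ (a ⊗ₜ u) = (γ • a) ⊗ₜ (γ • u) := rfl

theorem diagonalAction_mul (γ δ : Γ) (z : A ⊗[k] g) :
    diagonalAction k A g (γ * δ) z = diagonalAction k A g γ (diagonalAction k A g δ z) := by
  induction z with
  | zero => simp
  | tmul a u => simp only [diagonalAction_tmul, mul_smul]
  | add x y hx hy => simp only [map_add, hx, hy]

variable (k A g Γ) in
/-- The sum over the group, as a linear map onto the equivariant map algebra. -/
noncomputable def equivariantTrace [Fintype Γ] : A ⊗[k] g →ₗ[k] equivariantMapAlgebra Γ k A g :=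
  LinearMap.codRestrict (equivariantMapAlgebra Γ k A g).toSubmodule
    (∑ γ : Γ, (diagonalAction k A g γ : A ⊗[k] g →ₗ[k] A ⊗[k] g)) fun z δ => by
      simp only [LinearMap.sum_apply, map_sum, LieHom.coe_toLinearMap, ← diagonalAction_mul]
      exact Fintype.sum_equiv (Equiv.mulLeft δ) _ _ fun _ => rfl

theorem coe_equivariantTrace [Fintype Γ] (z : A ⊗[k] g) :
    (equivariantTrace k A g Γ z : A ⊗[k] g) = ∑ γ : Γ, diagonalAction k A g γ z := by
  change (∑ γ : Γ, (diagonalAction k A g γ : A ⊗[k] g →ₗ[k] A ⊗[k] g)) z = _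
  rw [LinearMap.sum_apply]
  rfl

theorem equivariantTrace_coe [Fintype Γ] (z : equivariantMapAlgebra Γ k A g) :
    equivariantTrace k A g Γ z = (Fintype.card Γ : k) • z := by
  ext
  rw [coe_equivariantTrace, Finset.sum_congr rfl fun γ _ => z.2 γ]
  simp [Nat.cast_smul_eq_nsmul]

/-- This orthogonality removes the cross terms from a bracket of two traces. -/
theorem sum_mul_smul_eq_ite {S : Finset (A × A)} [DecidableEq Γ]
    (hS : ∀ γ : Γ, ∑ p ∈ S, p.1 * γ • p.2 = if γ = 1 then 1 else 0) (γ δ : Γ) :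
    ∑ p ∈ S, γ • p.1 * δ • p.2 = if γ = δ then 1 else 0 := by
  have h := congrArg (γ • ·) (hS (γ⁻¹ * δ))
  simp only [Finset.smul_sum, smul_mul', smul_smul, mul_inv_cancel_left, inv_mul_eq_one] at h
  rw [h]
  split_ifs <;> simp

/-- The trace of `(a * b) ⊗ ⁅u, w⁆` is a sum of brackets of traces. -/
theorem equivariantTrace_mul_tmul_lie [Fintype Γ] [DecidableEq Γ] {S : Finset (A × A)}
    (hS : ∀ γ : Γ, ∑ p ∈ S, p.1 * γ • p.2 = if γ = 1 then 1 else 0) (a b : A) (u w : g) :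
    equivariantTrace k A g Γ ((a * b) ⊗ₜ ⁅u, w⁆) =
      ∑ p ∈ S, ⁅equivariantTrace k A g Γ ((a * p.1) ⊗ₜ u),
        equivariantTrace k A g Γ ((b * p.2) ⊗ₜ w)⁆ := by
  ext
  symm
  calc _ = ∑ p ∈ S, ∑ γ : Γ, ∑ δ : Γ,
        (γ • a * δ • b * (γ • p.1 * δ • p.2)) ⊗ₜ[k] ⁅γ • u, δ • w⁆ := by
        rw [AddSubmonoidClass.coe_finsetSum]
        refine Finset.sum_congr rfl fun p _ => ?_
        rw [LieSubalgebra.coe_bracket, coe_equivariantTrace, coe_equivariantTrace,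
          sum_lie_sum]
        refine Finset.sum_congr rfl fun γ _ => Finset.sum_congr rfl fun δ _ => ?_
        rw [diagonalAction_tmul, diagonalAction_tmul, LieAlgebra.ExtendScalars.bracket_tmul,
          smul_mul', smul_mul', mul_mul_mul_comm]
    _ = ∑ γ : Γ, ∑ δ : Γ, (γ • a * δ • b * ∑ p ∈ S, γ • p.1 * δ • p.2) ⊗ₜ[k] ⁅γ • u, δ • w⁆ := by
        simp only [Finset.mul_sum, TensorProduct.sum_tmul]
        rw [Finset.sum_comm]
        exact Finset.sum_congr rfl fun γ _ => Finset.sum_comm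
    _ = _ := by
        simp only [sum_mul_smul_eq_ite hS, coe_equivariantTrace, diagonalAction_tmul, smul_mul',
          MulLieAction.smul_lie]
        refine Finset.sum_congr rfl fun γ _ => ?_
        rw [Finset.sum_eq_single γ (fun δ _ h => by simp [h.symm]) (by simp)]
        simp

end Trace

/-! ### The trace annihilator and its codimension -/

section Annihilator

variable {k A g Γ : Type*} [Field k] [CommRing A] [Algebra k A]
  [LieRing g] [LieAlgebra k g] [Group Γ] [Fintype Γ]
  [MulSemiringAction Γ A] [SMulCommClass Γ k A] [MulLieAction Γ g] [SMulCommClass Γ k g]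
  (V : Type*) [AddCommGroup V] [Module k V]
  [LieRingModule (equivariantMapAlgebra Γ k A g) V]
  [LieModule k (equivariantMapAlgebra Γ k A g) V]

variable (k A g Γ) in
/-- The action on `V` of the traces of elements of `A ⊗ g`. -/
noncomputable def traceToEnd : A ⊗[k] g →ₗ[k] Module.End k V :=
  LinearMap.mk₂ k (fun (x : equivariantMapAlgebra Γ k A g) (v : V) => ⁅x, v⁆) add_lie smul_lie
    lie_add (fun c x v => lie_smul c x v) ∘ₗ equivariantTrace k A g Γ

theorem traceToEnd_apply (z : A ⊗[k] g) (v : V) :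
    traceToEnd k A g Γ V z v = ⁅equivariantTrace k A g Γ z, v⁆ := rfl

variable (k A g Γ) in
/-- The largest ideal `J` of `A` such that the traces of the elements of `J ⊗ g` annihilate `V`. -/
noncomputable def traceAnnihilator : Ideal A where
  carrier := {a | ∀ (b : A) (u : g), traceToEnd k A g Γ V ((a * b) ⊗ₜ u) = 0}
  add_mem' {x y} hx hy b u := by rw [add_mul, TensorProduct.add_tmul, map_add, hx, hy, add_zero]
  zero_mem' b u := by rw [zero_mul, TensorProduct.zero_tmul, map_zero]
  smul_mem' c x hx b u := by rw [smul_eq_mul, mul_comm c, mul_assoc, hx]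

theorem traceToEnd_eq_zero_of_mem_tensorIdeal {z : A ⊗[k] g}
    (hz : z ∈ tensorIdeal k g (traceAnnihilator k A g Γ V)) : traceToEnd k A g Γ V z = 0 := by
  obtain ⟨y, rfl⟩ := hz
  induction y with
  | zero => simp
  | tmul a u => simpa using a.2 1 u
  | add x y hx hy => rw [map_add, map_add, hx, hy, add_zero]

/-- An equivariant element is a multiple of its trace. -/
theorem lie_eq_zero_of_mem_traceAnnihilator [CharZero k] {α : equivariantMapAlgebra Γ k A g}
    (hα : (α : A ⊗[k] g) ∈ tensorIdeal k g (traceAnnihilator k A g Γ V)) (v : V) :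
    ⁅α, v⁆ = 0 := by
  have h := congrArg (· v) (traceToEnd_eq_zero_of_mem_tensorIdeal V hα)
  simp only [traceToEnd_apply, equivariantTrace_coe, smul_lie, LinearMap.zero_apply] at h
  exact (smul_eq_zero.mp h).resolve_left (Nat.cast_ne_zero.mpr Fintype.card_ne_zero)

theorem mem_traceAnnihilator [LieAlgebra.IsSemisimple k g] [DecidableEq Γ] {S : Finset (A × A)}
    (hS : ∀ γ : Γ, ∑ p ∈ S, p.1 * γ • p.2 = if γ = 1 then 1 else 0) {a : A}
    (ha : ∀ p ∈ S, ∀ u : g, traceToEnd k A g Γ V ((a * p.1) ⊗ₜ u) = 0) :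
    a ∈ traceAnnihilator k A g Γ V := by
  intro b u
  have hu : u ∈ Submodule.span k {x : g | ∃ u w : g, ⁅u, w⁆ = x} :=
    LieAlgebra.IsSemisimple.span_lie_eq_top k g ▸ Submodule.mem_top
  induction hu using Submodule.span_induction with
  | zero => rw [TensorProduct.tmul_zero, map_zero]
  | add x y _ _ hx hy => rw [TensorProduct.tmul_add, map_add, hx, hy, add_zero]
  | smul c x _ hx => rw [TensorProduct.tmul_smul, map_smul, hx, smul_zero]
  | mem x hx =>
    obtain ⟨u, w, rfl⟩ := hx
    ext v
    rw [traceToEnd_apply, equivariantTrace_mul_tmul_lie hS, sum_lie]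
    refine Finset.sum_eq_zero fun p hp => ?_
    -- Both terms of the commutator contain the action of the trace of `a p₁ ⊗ u`, which is zero
    -- whatever `b` is.
    rw [lie_lie, ← traceToEnd_apply V ((a * p.1) ⊗ₜ u), ← traceToEnd_apply V ((a * p.1) ⊗ₜ u),
      ha p hp u]
    simp

theorem finite_quotient_traceAnnihilator [IsAlgClosed k] [Algebra.FiniteType k A]
    [FiniteDimensional k g] [LieAlgebra.IsSemisimple k g] [FiniteDimensional k V]
    (hfree : ∀ (γ : Γ) (x : RationalPoint k A), γ • x = x → γ = 1) :
    Module.Finite k (A ⧸ traceAnnihilator k A g Γ V) := by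
  classical
  obtain ⟨t, ht⟩ := exists_twistedMul_eq_ite hfree
  obtain ⟨S, rfl⟩ := TensorProduct.exists_finset t
  simp only [map_sum, twistedMul_tmul] at ht
  -- The target is finite-dimensional and the kernel lies in the trace annihilator.
  let Φ : A →ₗ[k] (S → g →ₗ[k] Module.End k V) :=
    LinearMap.pi fun p => TensorProduct.curry (traceToEnd k A g Γ V) ∘ₗ LinearMap.mulRight k p.1.1
  have hΦ : LinearMap.ker Φ ≤
      LinearMap.ker ((Ideal.Quotient.mkₐ k (traceAnnihilator k A g Γ V)).toLinearMap) := by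
    intro a ha
    refine Ideal.Quotient.eq_zero_iff_mem.mpr (mem_traceAnnihilator V ht fun p hp u => ?_)
    exact congrArg (· u) (congrFun (LinearMap.mem_ker.mp ha) ⟨p, hp⟩)
  have : Module.Finite k (A ⧸ LinearMap.ker Φ) :=
    Module.Finite.equiv Φ.quotKerEquivRange.symm
  refine Module.Finite.of_surjective ((LinearMap.ker Φ).liftQ _ hΦ) ?_
  intro y
  obtain ⟨a, rfl⟩ := Ideal.Quotient.mk_surjective y
  exact ⟨Submodule.Quotient.mk a, rfl⟩

end Annihilator

/-! ### Invariant elements and translates of an ideal -/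

section TensorIdeal

variable {k A g : Type*} [Field k] [CommRing A] [Algebra k A] [LieRing g] [LieAlgebra k g]

variable (A) in
/-- The map `a ⊗ u ↦ φ u • a` for a linear form `φ` on `g`. -/
noncomputable def tensorContract (φ : Module.Dual k g) : A ⊗[k] g →ₗ[k] A :=
  (TensorProduct.rid k A).toLinearMap ∘ₗ LinearMap.lTensor A φ

theorem tensorContract_tmul (φ : Module.Dual k g) (a : A) (u : g) :
    tensorContract A φ (a ⊗ₜ u) = φ u • a := by
  simp [tensorContract]

/-- Expanding in a basis of `g` reduces intersections of subspaces `g ⊗ I` to intersections of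
ideals. -/
theorem mem_tensorIdeal_iff [FiniteDimensional k g] {I : Ideal A} {z : A ⊗[k] g} :
    z ∈ tensorIdeal k g I ↔ ∀ φ : Module.Dual k g, tensorContract A φ z ∈ I := by
  constructor
  · rintro ⟨y, rfl⟩ φ
    induction y with
    | zero => simp
    | tmul a u =>
      simpa [tensorContract_tmul] using (I.restrictScalars k).smul_mem (φ u) a.2
    | add x y hx hy => simpa only [map_add] using add_mem hx hy
  · intro h
    let b := Module.finBasis k g
    have hz : z = ∑ i, tensorContract A (b.coord i) z ⊗ₜ[k] b i := by
      clear h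
      induction z with
      | zero => simp
      | tmul a u =>
        simp only [tensorContract_tmul, TensorProduct.smul_tmul, ← TensorProduct.tmul_sum,
          Module.Basis.coord_apply, b.sum_repr]
      | add x y hx hy =>
        simp only [map_add, TensorProduct.add_tmul, Finset.sum_add_distrib, ← hx, ← hy]
    rw [hz]
    exact sum_mem fun i _ => ⟨(⟨_, h (b.coord i)⟩ : I.restrictScalars k) ⊗ₜ b i, rfl⟩

variable {Γ : Type*} [Group Γ]
  [MulSemiringAction Γ A] [SMulCommClass Γ k A] [MulLieAction Γ g] [SMulCommClass Γ k g]

theorem tensorContract_diagonalAction (φ : Module.Dual k g) (γ : Γ) (z : A ⊗[k] g) :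
    tensorContract A φ (diagonalAction k A g γ z) =
      γ • tensorContract A (φ ∘ₗ (MulLieAction.toLieHom k g γ).toLinearMap) z := by
  induction z with
  | zero => simp
  | tmul a u =>
    rw [diagonalAction_tmul, tensorContract_tmul, tensorContract_tmul, smul_comm γ]
    rfl
  | add x y hx hy => simp only [map_add, smul_add, hx, hy]

/-- An equivariant element of `g ⊗ I` lies in `g ⊗ I'` if `I'` contains all elements that lie in
every translate of `I`. -/
theorem mem_tensorIdeal_of_iInf_smul_le [FiniteDimensional k g] {I I' : Ideal A}
    (h : ⨅ γ : Γ, γ • I ≤ I') {α : equivariantMapAlgebra Γ k A g}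
    (hα : α ∈ equivariantTensorIdeal Γ k g I) : (α : A ⊗[k] g) ∈ tensorIdeal k g I' := by
  refine mem_tensorIdeal_iff.mpr fun φ => h (Submodule.mem_iInf _ |>.mpr fun γ => ?_)
  rw [← α.2 γ, tensorContract_diagonalAction]
  exact Ideal.smul_mem_pointwise_smul _ _ _ (mem_tensorIdeal_iff.mp hα _)

end TensorIdeal

/-! ### Orbit representatives and the choice of `η` -/

section OrbitRepresentatives

variable {k A Γ : Type*} [Field k] [CommRing A] [Algebra k A]
  [Group Γ] [MulSemiringAction Γ A] [SMulCommClass Γ k A]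

/-- Powers of distinct maximal ideals are coprime, so the product is an intersection. The uniform
exponent bounds every multiplicity, so `η` can be constant on representatives even when points of
`Z` share an orbit. -/
theorem RationalPoint.iInf_pow_card_le_prod (Z : Multiset (RationalPoint k A)) :
    ⨅ x ∈ Z, x.ideal ^ Multiset.card Z ≤ (Z.map RationalPoint.ideal).prod := by
  classical
  have hcop : ∀ x ∈ Z.toFinset, ∀ y ∈ Z.toFinset, x ≠ y →
      IsCoprime (x.ideal ^ Z.count x) (y.ideal ^ Z.count y) := by
    intro x _ y _ hxy
    have := isMaximal_ideal k x
    have := isMaximal_ideal k y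
    exact (Ideal.isCoprime_of_isMaximal fun h => hxy (ext_ideal h)).pow
  rw [Finset.prod_multiset_map_count, Ideal.prod_eq_iInf_of_pairwise_isCoprime hcop]
  refine le_iInf₂ fun x hx => ?_
  exact (iInf₂_le x (Multiset.mem_toFinset.mp hx)).trans
    (Ideal.pow_le_pow_right (Multiset.count_le_card x Z))

/-- A product of ideals of rational points contains the intersection of the translates of `I_η` for
some `η` supported on representatives of distinct orbits. -/
theorem exists_iInf_smul_idealOfFun_le (Z : Multiset (RationalPoint k A)) :
    ∃ η : RationalPoint k A →₀ ℕ, η.support ∈ XStar Γ k A ∧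
      ⨅ γ : Γ, γ • idealOfFun η ≤ (Z.map RationalPoint.ideal).prod := by
  classical
  let rep : RationalPoint k A → RationalPoint k A := fun x =>
    (Quotient.mk (MulAction.orbitRel Γ (RationalPoint k A)) x).out
  have hrep (x) : ∃ γ : Γ, γ • rep x = x :=
    MulAction.orbitRel_apply.mp 
      ((MulAction.orbitRel Γ _).symm (Quotient.mk_out (s := MulAction.orbitRel Γ _) x))
  let η : RationalPoint k A →₀ ℕ :=
    Finsupp.indicator (Z.toFinset.image rep) fun _ _ => Multiset.card Z
  have hη (x) (hx : x ∈ Z) : η (rep x) = Multiset.card Z :=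
    Finsupp.indicator_of_mem (Finset.mem_image_of_mem rep (Multiset.mem_toFinset.mpr hx)) _
  refine ⟨η, ?_, ?_⟩
  · have hsupp : ∀ x ∈ η.support, ∃ y, rep y = x := fun x hx => by
      obtain ⟨y, _, hy⟩ := Finset.mem_image.mp (Finsupp.support_indicator_subset _ _ hx)
      exact ⟨y, hy⟩
    intro x hx y hy hxy
    obtain ⟨x, rfl⟩ := hsupp x hx
    obtain ⟨y, rfl⟩ := hsupp y hy
    refine (MulAction.orbit.eq_or_disjoint _ _).resolve_left fun h => hxy ?_
    have hrel : (MulAction.orbitRel Γ (RationalPoint k A)) (rep x) (rep y) :=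
      MulAction.orbitRel_apply.mpr (MulAction.orbit_eq_iff.mp h)
    have hq := Quotient.sound hrel
    simp only [rep, Quotient.out_eq] at hq
    exact congrArg Quotient.out hq
  · refine le_trans (le_iInf₂ fun x hx => ?_) (RationalPoint.iInf_pow_card_le_prod Z)
    obtain ⟨γ, hγ⟩ := hrep x
    refine (iInf_le _ γ).trans ?_
    have hle : idealOfFun η ≤ (rep x).ideal ^ Multiset.card Z := by
      have hmem : rep x ∈ η.support := by
        rw [Finsupp.mem_support_iff, hη x hx]
        exact (Multiset.card_pos_iff_exists_mem.mpr ⟨x, hx⟩).ne'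
      rw [← hη x hx]
      exact Ideal.le_of_dvd (Finset.dvd_prod_of_mem (fun y => y.ideal ^ η y) hmem)
    refine (smul_mono_right γ hle).trans ?_
    -- The translate by `γ` with `γ • rep x = x` recovers the power of `𝔪_x`.
    rw [smul_pow', ← RationalPoint.ideal_smul, hγ]

end OrbitRepresentatives

theorem mainTheorem6
    {k A g Γ V : Type*} [Field k] [IsAlgClosed k] [CharZero k]
    [CommRing A] [Algebra k A] [Algebra.FiniteType k A]
    [LieRing g] [LieAlgebra k g] [FiniteDimensional k g] [LieAlgebra.IsSemisimple k g]
    [CommGroup Γ] [Finite Γ]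
    [MulSemiringAction Γ A] [SMulCommClass Γ k A]
    [MulLieAction Γ g] [SMulCommClass Γ k g]
    (hfree : ∀ (γ : Γ) (x : RationalPoint k A), γ • x = x → γ = 1)
    [AddCommGroup V] [Module k V] [FiniteDimensional k V]
    [LieRingModule (equivariantMapAlgebra Γ k A g) V]
    [LieModule k (equivariantMapAlgebra Γ k A g) V] :
    ∃ η : RationalPoint k A →₀ ℕ, η.support ∈ XStar Γ k A ∧
      ∀ α ∈ equivariantTensorIdeal Γ k g (idealOfFun η), ∀ v : V, ⁅α, v⁆ = 0 := by
  have := Fintype.ofFinite Γ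
  have := finite_quotient_traceAnnihilator (g := g) V hfree
  obtain ⟨Z, hZ⟩ := RationalPoint.exists_multiset_prod_le k (traceAnnihilator k A g Γ V)
  obtain ⟨η, hη, hle⟩ := exists_iInf_smul_idealOfFun_le (Γ := Γ) Z
  exact ⟨η, hη, fun α hα => lie_eq_zero_of_mem_traceAnnihilator V
    (mem_tensorIdeal_of_iInf_smul_le (hle.trans hZ) hα)⟩
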